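/- For $n\ge 1$ let $S_n$ be the group of permutations of $\{1,\dots,n\}$ with the uniform probability measure $P$ and expectation $E$. For $\sigma\in S_n$ and an integer $k\ge 0$ let $Z_{n,k}(\sigma)$ be the number of increasing subsequences of length $k$ in $\sigma$, that is, the number of index sets $i_1<i_2<\dots<i_k$ in $\{1,\dots,n\}$ with $\sigma(i_1)<\sigma(i_2)<\dots<\sigma(i_k)$. Let $(k_n)_{n\ge1}$ be a sequence of nonnegative integers. (i) If $k_n=o(n^{2/5})$ as $n\to\infty$, then $\dfrac{Z_{n,k_n}}{EZ_{n,k_n}}\to 1$ in probability, that is, for every $\varepsilon>0$, $$\lim_{n\to\infty}P\left(\left|\frac{Z_{n,k_n}}{EZ_{n,k_n}}-1\right|>\varepsilon\right)=0.$$ (ii) If $k_n=O(n^{2/5})$ as $n\to\infty$, then there is $\delta>0$ (which may depend on the sequence $(k_n)$) such that $$\liminf_{n\to\infty}P\left(\frac{Z_{n,k_n}}{EZ_{n,k_n}}>\delta\right)>0.$$ (Under either hypothesis $k_n\le n$ for all large $n$, so that $EZ_{n,k_n}>0$ and the quotient is defined; the finitely many other $n$ play no role.) -/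

import Mathlib

open Filter Topology MeasureTheory Asymptotics

namespace IncreasingSubsequences

/-- `S_n`, realized as the permutations of `Fin n`, is a finite discrete measurable space. -/
instance instMeasurableSpacePerm (n : ℕ) : MeasurableSpace (Equiv.Perm (Fin n)) := ⊤

/-- The uniform probability measure `U_n` on `S_n`. -/
noncomputable def U (n : ℕ) : Measure (Equiv.Perm (Fin n)) :=
  (PMF.uniformOfFintype (Equiv.Perm (Fin n))).toMeasure

/-- `Z n k σ` is the number of increasing subsequences of length `k` in the word
`σ 0, σ 1, …, σ (n - 1)`. A subsequence is given by its set `S` of positions; since the entries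
of the word are distinct, this is the same as giving its set of values. -/
def Z (n k : ℕ) (σ : Equiv.Perm (Fin n)) : ℕ :=
  ((Finset.univ.powersetCard k).filter
    (fun S : Finset (Fin n) => ∀ i ∈ S, ∀ j ∈ S, i < j → σ i < σ j)).card

/-- The expected value `E Z_{n,k}` under the uniform measure. -/
noncomputable def EZ (n k : ℕ) : ℝ := ∫ σ, (Z n k σ : ℝ) ∂(U n)

end IncreasingSubsequences

/-!
The proof is the second moment method. Write `v = C(n, k) / k!`, a lower bound for (in fact the
value of) the mean of `Z`. The square of `Z` counts pairs `(S, T)` of `k`-element sets on both of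
which `σ` is increasing, and the pairs are sorted by the size `j` of `S ∩ T`.

Such a `σ` is determined on `S ∪ T` by the images of `S` and `T`, and these images have the same
interleaving pattern as `(S, T)`: cut at its common elements, a pair `(S, T)` is described by the
sizes `aᵢ`, `bᵢ` of the pieces of `S \ T` and `T \ S` in the `j + 1` gaps, and `σ` preserves all of
them (`commonPattern_image`). With a given pattern there are at most
`C(n, 2k - j) ∏ᵢ C(aᵢ + bᵢ, aᵢ)` pairs (`pairCount_le`), so the contribution of `j` to the second
moment is at most `C(n, 2k - j) / (2k - j)!` times the sum of `∏ᵢ C(aᵢ + bᵢ, aᵢ)²` over all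
patterns (`sum_Z_sq_le`).

In each square one factor is bounded by `C(t, a) ≤ 2ᵗ / √(t + 1)`, and the product of the others is
summed by Vandermonde's identity. What is left is `C(2N, N) 4ᴺ`, with `N = k - j`, times the
coefficient of `X²ᴺ` in the `(j + 1)`-st power of `∑ₜ Xᵗ / √(t + 1)` (`sum_patternWeight_sq_le`).
That coefficient is at most `12ʲ (2k)^((j - 1) / 2) / ⌊(j - 1) / 2⌋!` (`coeff_pow_le`), because the
coefficients of the square of the series are bounded. Relative to `v²`, the pairs with `j ≥ 1`
common elements therefore contribute at most `yʲ / ⌊(j - 1) / 2⌋!` with `y = 9 (2k)^(5/2) / n`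
(`overlap_term_le`), and those with `j = 0` at most `1`, so that
`E Z² ≤ v² (1 + (y + y²) exp (y²))` if `2k ≤ n` (`second_moment_le`). This is where the exponent `2/5` comes
from: `y → 0` if `k = o(n^(2/5))`, and `y` is bounded if `k = O(n^(2/5))`. Chebyshev's inequality
gives the first statement, and the Paley–Zygmund inequality the second.
-/

/-! ### Central binomial coefficients and powers of the series `∑ₜ Xᵗ / √(t + 1)` -/

namespace IncreasingSubsequences

theorem centralBinom_sq_mul_le (m : ℕ) : m.centralBinom ^ 2 * (2 * m + 1) ≤ 16 ^ m := by
  induction m with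
  | zero => simp
  | succ m ih =>
    have h := Nat.succ_mul_centralBinom_succ m
    have h1 : (m + 1) ^ 2 * ((m + 1).centralBinom ^ 2 * (2 * (m + 1) + 1))
        = (4 * (2 * m + 1) * (2 * m + 3)) * (m.centralBinom ^ 2 * (2 * m + 1)) := by
      calc _ = ((m + 1) * (m + 1).centralBinom) ^ 2 * (2 * m + 3) := by ring
        _ = _ := by rw [h]; ring
    have h2 : (4 * (2 * m + 1) * (2 * m + 3)) * (m.centralBinom ^ 2 * (2 * m + 1))
        ≤ (m + 1) ^ 2 * 16 * 16 ^ m := by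
      apply Nat.mul_le_mul _ ih
      nlinarith
    have h3 : (m + 1) ^ 2 * ((m + 1).centralBinom ^ 2 * (2 * (m + 1) + 1))
        ≤ (m + 1) ^ 2 * 16 ^ (m + 1) := by
      rw [h1, pow_succ 16]; linarith
    exact Nat.le_of_mul_le_mul_left h3 (by positivity)

theorem le_centralBinom_sq_mul (m : ℕ) : 16 ^ m ≤ m.centralBinom ^ 2 * (4 * m + 1) := by
  induction m with
  | zero => simp
  | succ m ih =>
    have h := Nat.succ_mul_centralBinom_succ m
    have h1 : (m + 1) ^ 2 * ((m + 1).centralBinom ^ 2 * (4 * (m + 1) + 1)) * (4 * m + 1)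
        = (4 * (2 * m + 1) ^ 2 * (4 * m + 5)) * (m.centralBinom ^ 2 * (4 * m + 1)) := by
      calc _ = ((m + 1) * (m + 1).centralBinom) ^ 2 * (4 * m + 5) * (4 * m + 1) := by ring
        _ = _ := by rw [h]; ring
    have h2 : ((m + 1) ^ 2 * 16 * (4 * m + 1)) * 16 ^ m ≤
        (4 * (2 * m + 1) ^ 2 * (4 * m + 5)) * (m.centralBinom ^ 2 * (4 * m + 1)) := by
      apply Nat.mul_le_mul _ ih
      nlinarith
    have h3 : ((m + 1) ^ 2 * (4 * m + 1)) * 16 ^ (m + 1) ≤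
        ((m + 1) ^ 2 * (4 * m + 1)) * ((m + 1).centralBinom ^ 2 * (4 * (m + 1) + 1)) := by
      rw [pow_succ 16]; linarith
    exact Nat.le_of_mul_le_mul_left h3 (by positivity)

theorem choose_sq_mul_le (t l : ℕ) : t.choose l ^ 2 * (t + 1) ≤ 4 ^ t := by
  obtain ⟨m, rfl | rfl⟩ := Nat.even_or_odd' t
  · calc (2 * m).choose l ^ 2 * (2 * m + 1) ≤ m.centralBinom ^ 2 * (2 * m + 1) := by
          gcongr; exact Nat.choose_le_centralBinom l m
      _ ≤ 16 ^ m := centralBinom_sq_mul_le m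
      _ = 4 ^ (2 * m) := by rw [pow_mul]; norm_num
  · have h1 : 2 * (2 * m + 1).choose l ≤ (m + 1).centralBinom := by
      have h := Nat.choose_le_middle l (2 * m + 1)
      have h' : (2 * m + 1) / 2 = m := by omega
      rw [h'] at h
      have h2 : (m + 1).centralBinom = (2 * m + 1).choose m + (2 * m + 1).choose (m + 1) := by
        rw [Nat.centralBinom, mul_add, mul_one, Nat.choose_succ_succ' (2 * m + 1)]
      have h3 : (2 * m + 1).choose (m + 1) = (2 * m + 1).choose m :=
        Nat.choose_symm_half m
      omega
    have h2 := centralBinom_sq_mul_le (m + 1)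
    have h3 : (2 * (2 * m + 1).choose l) ^ 2 * (2 * m + 2) ≤
        (m + 1).centralBinom ^ 2 * (2 * (m + 1) + 1) :=
      Nat.mul_le_mul (Nat.pow_le_pow_left h1 2) (by omega)
    have h4 : (16 : ℕ) ^ (m + 1) = 4 * 4 ^ (2 * m + 1) := by
      rw [show (16 : ℕ) = 4 ^ 2 by norm_num, ← pow_mul]; ring
    nlinarith

/-- The maximal point probability of `t` fair coin tosses is at most `1 / √(t + 1)`. -/
theorem choose_le_two_pow_div_sqrt (t l : ℕ) :
    (t.choose l : ℝ) ≤ 2 ^ t * (1 / √(t + 1 : ℝ)) := by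
  have h : ((t.choose l : ℝ)) ^ 2 * (t + 1) ≤ 4 ^ t := by exact_mod_cast choose_sq_mul_le t l
  rw [mul_one_div, le_div_iff₀ (by positivity)]
  apply le_of_sq_le_sq _ (by positivity)
  rw [mul_pow, Real.sq_sqrt (by positivity), ← pow_mul, mul_comm t 2, pow_mul]
  norm_num; exact h

/-- The power series `∑ₜ Xᵗ / √(t + 1)`. -/
noncomputable def invSqrtSeries : PowerSeries ℝ := PowerSeries.mk fun t => 1 / √(t + 1 : ℝ)

open PowerSeries in
theorem coeff_invSqrtSeries (t : ℕ) : coeff t invSqrtSeries = 1 / √(t + 1 : ℝ) := by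
  simp [invSqrtSeries]

open PowerSeries in
theorem coeff_pow_invSqrtSeries_nonneg (m t : ℕ) : 0 ≤ coeff t (invSqrtSeries ^ m) := by
  induction m generalizing t with
  | zero => simp [coeff_one]; split_ifs <;> simp
  | succ m ih =>
    rw [pow_succ, coeff_mul]
    refine Finset.sum_nonneg fun p _ => mul_nonneg (ih _) ?_
    rw [coeff_invSqrtSeries]; positivity

theorem sum_inv_sqrt_le (M : ℕ) :
    ∑ s ∈ Finset.range M, 1 / √(s + 1 : ℝ) ≤ 2 * √(M : ℝ) := by
  induction M with
  | zero => simp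
  | succ M ih =>
    rw [Finset.sum_range_succ]
    have h1 : 1 / √(M + 1 : ℝ) ≤ 2 * √(M + 1 : ℝ) - 2 * √(M : ℝ) := by
      rw [div_le_iff₀ (by positivity)]
      have ha := Real.sq_sqrt (show (0 : ℝ) ≤ M + 1 by positivity)
      have hb := Real.sq_sqrt (show (0 : ℝ) ≤ M by positivity)
      nlinarith [sq_nonneg (√(M + 1 : ℝ) - √(M : ℝ))]
    push_cast; linarith

open PowerSeries in
/-- `∑ 1 / √((s + 1) (M - s + 1))` is bounded: one of the two factors is at most `√(2 / (M + 2))`,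
and the sum of the other one is `O(√M)`. -/
theorem coeff_invSqrtSeries_sq_le (M : ℕ) : coeff M (invSqrtSeries ^ 2) ≤ 6 := by
  rw [pow_two, coeff_mul]
  simp only [coeff_invSqrtSeries]
  have hc : (0 : ℝ) < √(M + 2 : ℝ) := by positivity
  have key : ∀ p ∈ Finset.HasAntidiagonal.antidiagonal M, 1 / √(p.1 + 1 : ℝ) * (1 / √(p.2 + 1 : ℝ)) ≤
      (√2 / √(M + 2 : ℝ)) * (1 / √(p.1 + 1 : ℝ) + 1 / √(p.2 + 1 : ℝ)) := by
    intro p hp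
    have hp' : (p.1 : ℝ) + p.2 = M := by exact_mod_cast Finset.HasAntidiagonal.mem_antidiagonal.mp hp
    have aux : ∀ a : ℝ, 0 ≤ a → (M : ℝ) ≤ 2 * a → 1 / √(a + 1) ≤ √2 / √(M + 2 : ℝ) := by
      intro a ha h
      rw [div_le_div_iff₀ (by positivity) hc, one_mul, ← Real.sqrt_mul (by norm_num)]
      apply Real.sqrt_le_sqrt; linarith
    have h0 : (0 : ℝ) ≤ √2 / √(M + 2 : ℝ) := by positivity
    have h1 : (0 : ℝ) ≤ 1 / √(p.1 + 1 : ℝ) := by positivity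
    have h2 : (0 : ℝ) ≤ 1 / √(p.2 + 1 : ℝ) := by positivity
    rcases le_total p.1 p.2 with h | h
    · have h' : (p.1 : ℝ) ≤ p.2 := by exact_mod_cast h
      have := aux p.2 (by positivity) (by linarith)
      nlinarith [mul_le_mul_of_nonneg_left this h1, mul_nonneg h0 h2]
    · have h' : (p.2 : ℝ) ≤ p.1 := by exact_mod_cast h
      have := aux p.1 (by positivity) (by linarith)
      nlinarith [mul_le_mul_of_nonneg_right this h2, mul_nonneg h0 h1]
  have hsum := sum_inv_sqrt_le (M + 1)
  have e1 : ∑ p ∈ Finset.HasAntidiagonal.antidiagonal M, 1 / √(p.1 + 1 : ℝ) =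
      ∑ s ∈ Finset.range (M + 1), 1 / √(s + 1 : ℝ) :=
    Finset.Nat.sum_antidiagonal_eq_sum_range_succ (fun i _ => 1 / √(i + 1 : ℝ)) M
  have e2 : ∑ p ∈ Finset.HasAntidiagonal.antidiagonal M, 1 / √(p.2 + 1 : ℝ) =
      ∑ s ∈ Finset.range (M + 1), 1 / √(s + 1 : ℝ) := by
    rw [← e1]
    exact Finset.Nat.sum_antidiagonal_swap (f := fun p => 1 / √(p.1 + 1 : ℝ))
  refine (Finset.sum_le_sum key).trans ?_
  rw [← Finset.mul_sum, Finset.sum_add_distrib, e1, e2]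
  have hs : √((M + 1 : ℕ) : ℝ) ≤ √(M + 2 : ℝ) := by
    apply Real.sqrt_le_sqrt; push_cast; linarith
  have h2 : √2 ≤ (1.5 : ℝ) := by
    rw [Real.sqrt_le_left (by norm_num)]; norm_num
  calc _ ≤ (√2 / √(M + 2 : ℝ)) * (4 * √(M + 2 : ℝ)) := by gcongr; linarith
    _ = 4 * √2 := by field_simp
    _ ≤ 6 := by linarith

/-- The hockey-stick identity. -/
theorem sum_choose_hockey (M r : ℕ) :
    ∑ s ∈ Finset.range (M + 1), (s + r).choose r = (M + (r + 1)).choose (r + 1) := by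
  induction M with
  | zero => simp
  | succ M ih =>
    rw [Finset.sum_range_succ, ih, show M + 1 + (r + 1) = (M + 1 + r) + 1 by ring,
      Nat.choose_succ_succ', show M + (r + 1) = M + 1 + r by ring, add_comm]

open PowerSeries in
/-- Multiplication by the square of the series costs at most six times a summation. -/
theorem coeff_pow_add_two_le (m M : ℕ) :
    coeff M (invSqrtSeries ^ (m + 2)) ≤
      6 * ∑ s ∈ Finset.range (M + 1), coeff s (invSqrtSeries ^ m) := by
  rw [pow_add, coeff_mul, Finset.mul_sum,
    ← Finset.Nat.sum_antidiagonal_eq_sum_range_succ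
      (fun i _ => 6 * coeff i (invSqrtSeries ^ m)) M]
  refine Finset.sum_le_sum fun p _ => ?_
  have h1 := coeff_invSqrtSeries_sq_le p.2
  have h2 := coeff_pow_invSqrtSeries_nonneg m p.1
  nlinarith

open PowerSeries in
theorem coeff_even_pow_le (r M : ℕ) :
    coeff M (invSqrtSeries ^ (2 * r + 2)) ≤ 6 ^ (r + 1) * ((M + r).choose r : ℝ) := by
  induction r generalizing M with
  | zero => simpa using coeff_invSqrtSeries_sq_le M
  | succ r ih =>
    refine (coeff_pow_add_two_le _ M).trans ?_
    calc _ ≤ 6 * ∑ s ∈ Finset.range (M + 1), 6 ^ (r + 1) * ((s + r).choose r : ℝ) := by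
          gcongr with s _; exact ih s
      _ = 6 ^ (r + 1 + 1) * ((∑ s ∈ Finset.range (M + 1), (s + r).choose r : ℕ) : ℝ) := by
          rw [← Finset.mul_sum]; push_cast; ring
      _ = _ := by rw [sum_choose_hockey]

open PowerSeries in
theorem coeff_odd_pow_le (r M : ℕ) :
    coeff M (invSqrtSeries ^ (2 * r + 3)) ≤
      2 * √(M + 1 : ℝ) * (6 ^ (r + 1) * ((M + r).choose r : ℝ)) := by
  induction r generalizing M with
  | zero =>
    refine (coeff_pow_add_two_le 1 M).trans ?_
    have := sum_inv_sqrt_le (M + 1)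
    push_cast at this
    simp only [pow_one, coeff_invSqrtSeries, zero_add, Nat.choose_zero_right, Nat.cast_one]
    linarith
  | succ r ih =>
    refine (coeff_pow_add_two_le (2 * r + 3) M).trans ?_
    calc _ ≤ 6 * ∑ s ∈ Finset.range (M + 1),
            2 * √(M + 1 : ℝ) * (6 ^ (r + 1) * ((s + r).choose r : ℝ)) := by
          gcongr with s hs
          refine (ih s).trans ?_
          have : (s : ℝ) ≤ M := by
            exact_mod_cast Nat.lt_succ_iff.mp (Finset.mem_range.mp hs)
          gcongr
      _ = 2 * √(M + 1 : ℝ) * (6 ^ (r + 1 + 1) *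
            ((∑ s ∈ Finset.range (M + 1), (s + r).choose r : ℕ) : ℝ)) := by
          rw [← Finset.mul_sum, ← Finset.mul_sum]; push_cast; ring
      _ = _ := by rw [sum_choose_hockey]

open PowerSeries in
/-- The coefficients of the powers of `∑ₜ Xᵗ / √(t + 1)`, in the form in which they bound the
contribution of the pairs of index sets with `j + 1` common elements. -/
theorem coeff_pow_le (j M K : ℕ) (h : M + j + 1 ≤ K) :
    coeff M (invSqrtSeries ^ (j + 2)) ≤ 12 ^ (j + 1) * √(K : ℝ) ^ j / (j / 2).factorial := by
  have hK : √(K : ℝ) ^ 2 = K := Real.sq_sqrt (by positivity)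
  have aux : ∀ r, r ≤ j → ((M + r).choose r : ℝ) ≤ √(K : ℝ) ^ (2 * r) / r.factorial := by
    intro r hr
    refine (Nat.choose_le_pow_div r (M + r)).trans ?_
    rw [pow_mul, hK]
    gcongr
    exact_mod_cast (by omega : M + r ≤ K)
  obtain ⟨r, rfl | rfl⟩ := Nat.even_or_odd' j
  · rw [show 2 * r / 2 = r by omega]
    refine (coeff_even_pow_le r M).trans ?_
    rw [mul_div_assoc]
    have : (6 : ℝ) ^ (r + 1) ≤ 12 ^ (2 * r + 1) := by
      calc (6 : ℝ) ^ (r + 1) ≤ 12 ^ (r + 1) := by gcongr; norm_num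
        _ ≤ _ := by gcongr; norm_num; omega
    gcongr
    exact aux r (by omega)
  · rw [show (2 * r + 1) / 2 = r by omega]
    refine (coeff_odd_pow_le r M).trans ?_
    have h1 : (2 : ℝ) * 6 ^ (r + 1) ≤ 12 ^ (2 * r + 1 + 1) := by
      calc (2 : ℝ) * 6 ^ (r + 1) ≤ 2 ^ (r + 1) * 6 ^ (r + 1) := by
            gcongr; exact le_self_pow₀ (by norm_num) (by omega)
        _ = 12 ^ (r + 1) := by rw [← mul_pow]; norm_num
        _ ≤ _ := by gcongr; norm_num; omega
    have h2 : √(M + 1 : ℝ) ≤ √(K : ℝ) := by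
      apply Real.sqrt_le_sqrt; exact_mod_cast (by omega : M + 1 ≤ K)
    calc _ = (2 * 6 ^ (r + 1)) * (√(M + 1 : ℝ) * ((M + r).choose r : ℝ)) := by ring
      _ ≤ 12 ^ (2 * r + 1 + 1) * (√(K : ℝ) * (√(K : ℝ) ^ (2 * r) / r.factorial)) := by
          gcongr; exact aux r (by omega)
      _ = _ := by ring

end IncreasingSubsequences

/-! ### Interleaving patterns of pairs of sets -/

namespace IncreasingSubsequences

open Finset in
/-- The interleaving pattern of two finite sets: for each common element `c`, in decreasing order,
the numbers of elements of `S \ T` and of `T \ S` below `c`. -/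
def commonPattern {α : Type*} [LinearOrder α] (S T : Finset α) : List (ℕ × ℕ) :=
  ((S ∩ T).sort (· ≥ ·)).map fun c => (#{a ∈ S \ T | a < c}, #{b ∈ T \ S | b < c})

theorem length_commonPattern {α : Type*} [LinearOrder α] (S T : Finset α) :
    (commonPattern S T).length = (S ∩ T).card := by
  simp [commonPattern]

theorem sort_image_of_strictMonoOn {α β : Type*} [LinearOrder α] [LinearOrder β] (f : α → β)
    (C : Finset α) (hf : StrictMonoOn f C) :
    (C.image f).sort (· ≥ ·) = (C.sort (· ≥ ·)).map f := by
  apply List.Perm.eq_of_pairwise (le := (· ≥ ·))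
  · intro a b _ _ h1 h2
    exact le_antisymm h2 h1
  · exact Finset.pairwise_sort _ _
  · rw [List.pairwise_map]
    refine (Finset.pairwise_sort C (· ≥ ·)).imp_of_mem ?_
    intro a b ha hb h
    exact hf.monotoneOn (by simpa using hb) (by simpa using ha) h
  · rw [List.perm_ext_iff_of_nodup]
    · intro b; simp
    · exact Finset.sort_nodup _ _
    · refine (List.nodup_map_iff_inj_on (Finset.sort_nodup C _)).mpr ?_
      intro a ha b hb h
      exact hf.injOn (by simpa using ha) (by simpa using hb) h

open Finset in
/-- The pattern of a pair of sets is unchanged by a map that is increasing on each of the two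
sets, even if it is not increasing on their union. -/
theorem commonPattern_image {α β : Type*} [LinearOrder α] [LinearOrder β] (f : α → β)
    (S T : Finset α) (hS : StrictMonoOn f S) (hT : StrictMonoOn f T)
    (hinj : Function.Injective f) :
    commonPattern (S.image f) (T.image f) = commonPattern S T := by
  unfold commonPattern
  have h0 : S.image f ∩ T.image f = (S ∩ T).image f := (image_inter S T hinj).symm
  have h1 : S.image f \ T.image f = (S \ T).image f := (image_sdiff S T hinj).symm
  have h2 : T.image f \ S.image f = (T \ S).image f := (image_sdiff T S hinj).symm
  rw [h0, h1, h2, sort_image_of_strictMonoOn f _ (hS.mono (by simp)), List.map_map]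
  apply List.map_congr_left
  intro c hc
  have hc' : c ∈ S ∧ c ∈ T := by simpa using hc
  have key : ∀ X Y : Finset α, StrictMonoOn f X → c ∈ X →
      #{b ∈ (X \ Y).image f | b < f c} = #{a ∈ X \ Y | a < c} := by
    intro X Y hX hcX
    rw [filter_image, card_image_of_injective _ hinj]
    congr 1
    apply filter_congr
    intro a ha
    exact hX.lt_iff_lt (mem_coe.mpr (mem_sdiff.mp ha).1) (mem_coe.mpr hcX)
  simp only [Function.comp]
  rw [key S T hS hc'.1, key T S hT hc'.2]

open Finset in
theorem notMem_of_subset_range {n : ℕ} {S T : Finset ℕ} (hS : S ⊆ range n) (hT : T ⊆ range n) :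
    n ∉ S ∧ n ∉ T :=
  ⟨fun h => by simpa using hS h, fun h => by simpa using hT h⟩

open Finset in
theorem commonPattern_insert_left {n : ℕ} {S T : Finset ℕ} (hS : S ⊆ range n)
    (hT : T ⊆ range n) : commonPattern (insert n S) T = commonPattern S T := by
  obtain ⟨h1, h2⟩ := notMem_of_subset_range hS hT
  unfold commonPattern
  rw [insert_inter_of_notMem h2]
  apply List.map_congr_left
  intro c hc
  have hc' : c ∈ S ∧ c ∈ T := by simpa using hc
  have hcn : c < n := by simpa using hS hc'.1
  rw [insert_sdiff_of_notMem _ h2, filter_insert, if_neg (by omega), sdiff_insert_of_notMem h2]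

open Finset in
theorem commonPattern_insert_right {n : ℕ} {S T : Finset ℕ} (hS : S ⊆ range n)
    (hT : T ⊆ range n) : commonPattern S (insert n T) = commonPattern S T := by
  obtain ⟨h1, h2⟩ := notMem_of_subset_range hS hT
  unfold commonPattern
  rw [inter_insert_of_notMem h1]
  apply List.map_congr_left
  intro c hc
  have hc' : c ∈ S ∧ c ∈ T := by simpa using hc
  have hcn : c < n := by simpa using hS hc'.1
  rw [insert_sdiff_of_notMem _ h1, filter_insert, if_neg (by omega), sdiff_insert_of_notMem h1]

open Finset in
theorem insert_sdiff_insert_of_notMem {n : ℕ} {S T : Finset ℕ} (h : n ∉ S) :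
    insert n S \ insert n T = S \ T := by
  rw [insert_sdiff_insert, sdiff_insert_of_notMem h]

open Finset in
theorem commonPattern_insert_insert {n : ℕ} {S T : Finset ℕ} (hS : S ⊆ range n)
    (hT : T ⊆ range n) : commonPattern (insert n S) (insert n T) =
      (#(S \ T), #(T \ S)) :: commonPattern S T := by
  obtain ⟨h1, h2⟩ := notMem_of_subset_range hS hT
  unfold commonPattern
  rw [← insert_inter_distrib, sort_insert, List.map_cons, insert_sdiff_insert_of_notMem h1,
    insert_sdiff_insert_of_notMem h2, filter_true_of_mem, filter_true_of_mem]
  · intro b hb; simpa using hT (mem_sdiff.mp hb).1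
  · intro a ha; simpa using hS (mem_sdiff.mp ha).1
  · intro b hb
    have : b < n := by simpa using hS (mem_inter.mp hb).1
    exact this.le
  · simp [h1]

open Finset in
/-- The number of pairs of subsets `S, T` of `{0, …, n - 1}` with `x` elements in `S \ T`,
`y` elements in `T \ S` and pattern `R`. -/
def pairCount (n x y : ℕ) (R : List (ℕ × ℕ)) : ℕ :=
  ∑ S ∈ (range n).powerset, ∑ T ∈ (range n).powerset,
    if #(S \ T) = x ∧ #(T \ S) = y ∧ commonPattern S T = R then 1 else 0

/-- The number of pairs of sets with pattern `R` and union `{0, …, u - 1}`, where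
`u = x + y + R.length`: a product of binomial coefficients, one for each gap between consecutive
common elements, each counting the interleavings of the two sets in that gap. It is `0` if no pair
with these parameters exists. -/
def patternWeight : ℕ → ℕ → List (ℕ × ℕ) → ℕ
  | x, y, [] => (x + y).choose x
  | x, y, (x', y') :: R =>
    if x' ≤ x ∧ y' ≤ y then
      ((x - x') + (y - y')).choose (x - x') * patternWeight x' y' R
    else 0

/-- The sum of `F` over the parameters `(x, y, R)` of the pair that remains when the largest element
of `S ∪ T` is removed: this element lies in `S` only, in `T` only, or in both sets. In the last case
it is the first entry of `R`, since patterns are listed in decreasing order. -/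
def sumRemoveMax (F : ℕ → ℕ → List (ℕ × ℕ) → ℕ) (x y : ℕ) (R : List (ℕ × ℕ)) : ℕ :=
  (if x = 0 then 0 else F (x - 1) y R) + (if y = 0 then 0 else F x (y - 1) R) +
    (if R.head? = some (x, y) then F x y R.tail else 0)

open Finset in
/-- The second summand counts the pairs of which at least one set contains the new point `n`. -/
theorem pairCount_succ (n x y : ℕ) (R : List (ℕ × ℕ)) :
    pairCount (n + 1) x y R = pairCount n x y R + sumRemoveMax (pairCount n) x y R := by
  have e1 : (∑ S ∈ (range n).powerset, ∑ T ∈ (range n).powerset,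
      if #(insert n S \ T) = x ∧ #(T \ insert n S) = y ∧ commonPattern (insert n S) T = R
        then 1 else 0) = if x = 0 then 0 else pairCount n (x - 1) y R := by
    have h : ∀ S ∈ (range n).powerset, ∀ T ∈ (range n).powerset,
        (if #(insert n S \ T) = x ∧ #(T \ insert n S) = y ∧ commonPattern (insert n S) T = R
          then 1 else 0) = if x = 0 then 0 else
          if #(S \ T) = x - 1 ∧ #(T \ S) = y ∧ commonPattern S T = R then 1 else 0 := by
      intro S hS T hT
      rw [mem_powerset] at hS hT
      obtain ⟨h1, h2⟩ := notMem_of_subset_range hS hT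
      rw [commonPattern_insert_left hS hT, insert_sdiff_of_notMem _ h2,
        card_insert_of_notMem (by simp [h1]), sdiff_insert_of_notMem h2]
      rcases x with _ | x <;> simp
    rw [sum_congr rfl fun S hS => sum_congr rfl (h S hS)]
    split_ifs with hx
    · simp
    · rfl
  have e2 : (∑ S ∈ (range n).powerset, ∑ T ∈ (range n).powerset,
      if #(S \ insert n T) = x ∧ #(insert n T \ S) = y ∧ commonPattern S (insert n T) = R
        then 1 else 0) = if y = 0 then 0 else pairCount n x (y - 1) R := by
    have h : ∀ S ∈ (range n).powerset, ∀ T ∈ (range n).powerset,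
        (if #(S \ insert n T) = x ∧ #(insert n T \ S) = y ∧ commonPattern S (insert n T) = R
          then 1 else 0) = if y = 0 then 0 else
          if #(S \ T) = x ∧ #(T \ S) = y - 1 ∧ commonPattern S T = R then 1 else 0 := by
      intro S hS T hT
      rw [mem_powerset] at hS hT
      obtain ⟨h1, h2⟩ := notMem_of_subset_range hS hT
      rw [commonPattern_insert_right hS hT, insert_sdiff_of_notMem _ h1,
        card_insert_of_notMem (by simp [h2]), sdiff_insert_of_notMem h1]
      rcases y with _ | y <;> simp
    rw [sum_congr rfl fun S hS => sum_congr rfl (h S hS)]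
    split_ifs with hx
    · simp
    · rfl
  have e3 : (∑ S ∈ (range n).powerset, ∑ T ∈ (range n).powerset,
      if #(insert n S \ insert n T) = x ∧ #(insert n T \ insert n S) = y ∧
        commonPattern (insert n S) (insert n T) = R
        then 1 else 0) = if R.head? = some (x, y) then pairCount n x y R.tail else 0 := by
    have h : ∀ S ∈ (range n).powerset, ∀ T ∈ (range n).powerset,
        (if #(insert n S \ insert n T) = x ∧ #(insert n T \ insert n S) = y ∧
          commonPattern (insert n S) (insert n T) = R then 1 else 0) =
          if R.head? = some (x, y) then
          if #(S \ T) = x ∧ #(T \ S) = y ∧ commonPattern S T = R.tail then 1 else 0 else 0 := by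
      intro S hS T hT
      rw [mem_powerset] at hS hT
      obtain ⟨h1, h2⟩ := notMem_of_subset_range hS hT
      rw [commonPattern_insert_insert hS hT, insert_sdiff_insert_of_notMem h1,
        insert_sdiff_insert_of_notMem h2, ← ite_and]
      congr 1
      rcases R with _ | ⟨⟨x', y'⟩, R⟩
      · simp
      · simp only [List.cons.injEq, Prod.mk.injEq, List.head?_cons, Option.some.injEq,
          List.tail_cons, eq_iff_iff]
        constructor
        · rintro ⟨rfl, rfl, ⟨rfl, rfl⟩, rfl⟩; simp
        · rintro ⟨⟨rfl, rfl⟩, rfl, rfl, rfl⟩; simp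
    rw [sum_congr rfl fun S hS => sum_congr rfl (h S hS)]
    split_ifs with hx
    · rfl
    · simp
  unfold sumRemoveMax
  rw [← e1, ← e2, ← e3]
  unfold pairCount
  rw [range_add_one, sum_powerset_insert (by simp)]
  simp only [sum_powerset_insert (show n ∉ range n by simp), sum_add_distrib]
  ring

/-- Pascal's rule, written so that it covers the boundary of the triangle. -/
theorem sum_choose_pred_eq (a b : ℕ) (h : ¬(a = 0 ∧ b = 0)) :
    (if a = 0 then 0 else ((a - 1) + b).choose (a - 1)) +
      (if b = 0 then 0 else (a + (b - 1)).choose a) = (a + b).choose a := by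
  rcases a with _ | a <;> rcases b with _ | b
  · simp at h
  · simp
  · simp
  · simp only [Nat.add_eq_zero_iff, one_ne_zero, and_false, if_false, Nat.add_sub_cancel]
    rw [show a + 1 + (b + 1) = (a + (b + 1)) + 1 by ring, Nat.choose_succ_succ',
      show a + 1 + b = a + (b + 1) by ring]

theorem patternWeight_cons_add (x' y' a b : ℕ) (R : List (ℕ × ℕ)) :
    patternWeight (x' + a) (y' + b) ((x', y') :: R) =
      (a + b).choose a * patternWeight x' y' R := by
  simp [patternWeight]

theorem patternWeight_cons_eq_zero {x y x' y' : ℕ} (R : List (ℕ × ℕ))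
    (h : ¬(x' ≤ x ∧ y' ≤ y)) : patternWeight x y ((x', y') :: R) = 0 := by
  simp only [patternWeight, if_neg h]

/-- Pascal's rule in the last gap; if that gap is empty, the last element is a common one. -/
theorem sumRemoveMax_patternWeight_le (x y : ℕ) (R : List (ℕ × ℕ))
    (h : 0 < x + y + R.length) :
    sumRemoveMax patternWeight x y R ≤ patternWeight x y R := by
  unfold sumRemoveMax
  rcases R with _ | ⟨⟨x', y'⟩, R⟩
  · simp only [patternWeight, List.head?_nil, reduceCtorEq, if_false, add_zero]
    rw [sum_choose_pred_eq x y (by simp at h; omega)]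
  · by_cases hle : x' ≤ x ∧ y' ≤ y
    · obtain ⟨a, rfl⟩ := Nat.exists_eq_add_of_le hle.1
      obtain ⟨b, rfl⟩ := Nat.exists_eq_add_of_le hle.2
      have e1 : (if x' + a = 0 then 0 else
          patternWeight (x' + a - 1) (y' + b) ((x', y') :: R)) =
          (if a = 0 then 0 else ((a - 1) + b).choose (a - 1)) * patternWeight x' y' R := by
        rcases a with _ | a
        · rw [if_pos rfl, zero_mul]
          split_ifs with h0
          · rfl
          · exact patternWeight_cons_eq_zero _ (by omega)
        · rw [if_neg (by omega), if_neg (by omega), ← patternWeight_cons_add]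
          rfl
      have e2 : (if y' + b = 0 then 0 else
          patternWeight (x' + a) (y' + b - 1) ((x', y') :: R)) =
          (if b = 0 then 0 else (a + (b - 1)).choose a) * patternWeight x' y' R := by
        rcases b with _ | b
        · rw [if_pos rfl, zero_mul]
          split_ifs with h0
          · rfl
          · exact patternWeight_cons_eq_zero _ (by omega)
        · rw [if_neg (by omega), if_neg (by omega), ← patternWeight_cons_add]
          rfl
      rw [e1, e2, patternWeight_cons_add, List.head?_cons, List.tail_cons]
      by_cases h0 : a = 0 ∧ b = 0
      · obtain ⟨rfl, rfl⟩ := h0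
        simp
      · have hne : ¬ (some (x', y') = some (x' + a, y' + b)) := by
          simp only [Option.some.injEq, Prod.mk.injEq]; omega
        rw [if_neg hne, add_zero, ← add_mul, sum_choose_pred_eq a b h0]
    · have hne : ¬ (some (x', y') = some (x, y)) := by
        simp only [Option.some.injEq, Prod.mk.injEq]; omega
      rw [patternWeight_cons_eq_zero R hle,
        patternWeight_cons_eq_zero (x := x - 1) (y := y) R (by omega),
        patternWeight_cons_eq_zero (x := x) (y := y - 1) R (by omega), List.head?_cons, if_neg hne]
      simp

theorem sumRemoveMax_le (F G : ℕ → ℕ → List (ℕ × ℕ) → ℕ) (c x y : ℕ) (R : List (ℕ × ℕ))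
    (h : ∀ x' y' R', x' + y' + R'.length + 1 = x + y + R.length → F x' y' R' ≤ c * G x' y' R') :
    sumRemoveMax F x y R ≤ c * sumRemoveMax G x y R := by
  unfold sumRemoveMax
  rw [mul_add, mul_add]
  refine add_le_add (add_le_add ?_ ?_) ?_
  · split_ifs with h0
    · simp
    · exact h _ _ _ (by omega)
  · split_ifs with h0
    · simp
    · exact h _ _ _ (by omega)
  · split_ifs with h0
    · apply h
      rcases R with _ | ⟨p, R⟩
      · simp at h0
      · simp; ring
    · simp

/-- The factor `C(n, x + y + R.length)` chooses `S ∪ T`. -/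
theorem pairCount_le (n x y : ℕ) (R : List (ℕ × ℕ)) :
    pairCount n x y R ≤ n.choose (x + y + R.length) * patternWeight x y R := by
  induction n generalizing x y R with
  | zero =>
    simp only [pairCount, Finset.range_zero, Finset.powerset_empty, Finset.sum_singleton]
    split_ifs with h
    · obtain ⟨rfl, rfl, rfl⟩ := h
      simp [commonPattern, patternWeight]
    · simp
  | succ n ih =>
    rw [pairCount_succ]
    rcases Nat.eq_zero_or_pos (x + y + R.length) with h | h
    · obtain ⟨⟨rfl, rfl⟩, hR⟩ : (x = 0 ∧ y = 0) ∧ R.length = 0 := by omega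
      obtain rfl := List.length_eq_zero_iff.mp hR
      simpa [sumRemoveMax] using ih 0 0 []
    · obtain ⟨v, hv⟩ := Nat.exists_eq_succ_of_ne_zero h.ne'
      have h1 := ih x y R
      have h2 := sumRemoveMax_le (pairCount n) patternWeight (n.choose v) x y R
        fun x' y' R' h' => by
          have h3 := ih x' y' R'
          rwa [show x' + y' + R'.length = v by omega] at h3
      have h4 := Nat.mul_le_mul_left (n.choose v) (sumRemoveMax_patternWeight_le x y R h)
      rw [hv] at h1 ⊢
      rw [Nat.succ_eq_add_one, Nat.choose_succ_succ', add_mul]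
      rw [Nat.succ_eq_add_one] at h1
      omega

open Finset in
/-- The lists of length `j` with entries in `{0, …, K - 1}²`. -/
def boxLists (K : ℕ) : ℕ → Finset (List (ℕ × ℕ))
  | 0 => {[]}
  | j + 1 => ((range K ×ˢ range K) ×ˢ boxLists K j).image fun p => p.1 :: p.2

open Finset in
theorem mem_boxLists {K : ℕ} {R : List (ℕ × ℕ)} (h : ∀ p ∈ R, p.1 < K ∧ p.2 < K) :
    R ∈ boxLists K R.length := by
  induction R with
  | nil => simp [boxLists]
  | cons p R ih =>
    simp only [boxLists, List.length_cons, mem_image]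
    refine ⟨(p, R), ?_, rfl⟩
    have h1 := h p (by simp)
    simp [h1, ih fun q hq => h q (by simp [hq])]

open Finset in
theorem length_of_mem_boxLists {K j : ℕ} {R : List (ℕ × ℕ)} (h : R ∈ boxLists K j) :
    R.length = j := by
  induction j generalizing R with
  | zero => simp_all [boxLists]
  | succ j ih =>
    simp only [boxLists, mem_image, mem_product] at h
    obtain ⟨⟨p, R'⟩, h, rfl⟩ := h
    simp [ih h.2]

open Finset in
theorem sum_boxLists_succ (K j : ℕ) (F : List (ℕ × ℕ) → ℝ) :
    ∑ R ∈ boxLists K (j + 1), F R =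
      ∑ p ∈ range K ×ˢ range K, ∑ R ∈ boxLists K j, F (p :: R) := by
  rw [boxLists, sum_image, sum_product]
  rintro ⟨p, R⟩ _ ⟨p', R'⟩ _ h
  simpa using h

open Finset in
/-- A form of Vandermonde's identity: two-step lattice paths to `(x, y)`, grouped by the
antidiagonal on which the intermediate point lies. -/
theorem sum_box_vandermonde_le (x y : ℕ) (F : ℕ → ℝ) (hF : ∀ t, 0 ≤ F t) :
    ∑ p ∈ range (x + 1) ×ˢ range (y + 1),
      F (p.1 + p.2) * (((x - p.1) + (y - p.2)).choose (x - p.1) * (p.1 + p.2).choose p.1 : ℝ) ≤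
      (x + y).choose x * ∑ t ∈ range (x + y + 1), F t := by
  have h : ∀ t ∈ range (x + y + 1), F t * ((x + y).choose x : ℝ) =
      ∑ i ∈ range (x + 1), F t * ((x + y - t).choose (x - i) * t.choose i : ℝ) := by
    intro t ht
    rw [← mul_sum]
    congr 1
    have h1 := Nat.add_choose_eq t (x + y - t) x
    rw [show t + (x + y - t) = x + y by have := mem_range.mp ht; omega,
      Finset.Nat.sum_antidiagonal_eq_sum_range_succ
        (fun i j => t.choose i * (x + y - t).choose j) x] at h1
    rw [h1]; push_cast
    exact sum_congr rfl fun i _ => mul_comm _ _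
  rw [mul_comm, sum_mul, sum_congr rfl h, ← sum_product']
  rw [show (∑ p ∈ range (x + 1) ×ˢ range (y + 1),
      F (p.1 + p.2) * (((x - p.1) + (y - p.2)).choose (x - p.1) * (p.1 + p.2).choose p.1 : ℝ)) =
      ∑ q ∈ (range (x + 1) ×ˢ range (y + 1)).image (fun p => (p.1 + p.2, p.1)),
        F q.1 * ((x + y - q.1).choose (x - q.2) * q.1.choose q.2 : ℝ) from ?_]
  · apply sum_le_sum_of_subset_of_nonneg
    · intro q hq
      obtain ⟨p, hp, rfl⟩ := mem_image.mp hq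
      simp only [mem_product, mem_range] at hp ⊢
      omega
    · intro q _ _
      have := hF q.1
      positivity
  · rw [sum_image]
    · refine sum_congr rfl fun p hp => ?_
      simp only [mem_product, mem_range] at hp
      rw [show x + y - (p.1 + p.2) = (x - p.1) + (y - p.2) by omega]
    · rintro ⟨a, b⟩ _ ⟨a', b'⟩ _ h
      simp only [Prod.mk.injEq] at h ⊢
      omega

open Finset PowerSeries in
/-- One of the two factors of each squared binomial coefficient is bounded by
`choose_le_two_pow_div_sqrt`, and the other one is summed by Vandermonde's identity. -/
theorem sum_patternWeight_sq_le (K j x y : ℕ) :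
    ∑ R ∈ boxLists K j, (patternWeight x y R : ℝ) ^ 2 ≤
      (x + y).choose x * (2 ^ (x + y) * coeff (x + y) (invSqrtSeries ^ (j + 1))) := by
  induction j generalizing x y with
  | zero =>
    simp only [boxLists, sum_singleton, patternWeight, zero_add, pow_one, coeff_invSqrtSeries]
    rw [pow_two]
    gcongr
    have := choose_le_two_pow_div_sqrt (x + y) x
    push_cast at this ⊢; exact this
  | succ j ih =>
    rw [sum_boxLists_succ]
    have hterm : ∀ p : ℕ × ℕ, ∑ R ∈ boxLists K j, (patternWeight x y (p :: R) : ℝ) ^ 2 =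
        if p.1 ≤ x ∧ p.2 ≤ y then (((x - p.1) + (y - p.2)).choose (x - p.1) : ℝ) ^ 2 *
          ∑ R ∈ boxLists K j, (patternWeight p.1 p.2 R : ℝ) ^ 2 else 0 := by
      intro p
      split_ifs with h
      · rw [mul_sum]
        refine sum_congr rfl fun R _ => ?_
        simp only [patternWeight, if_pos h]; push_cast; ring
      · simp [patternWeight, h]
    simp only [hterm]
    rw [← sum_filter]
    have hsub : {p ∈ range K ×ˢ range K | p.1 ≤ x ∧ p.2 ≤ y} ⊆
        range (x + 1) ×ˢ range (y + 1) := by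
      intro p hp
      simp only [mem_filter, mem_product, mem_range] at hp ⊢
      omega
    refine (sum_le_sum_of_subset_of_nonneg hsub fun p _ _ =>
      mul_nonneg (by positivity) (sum_nonneg fun _ _ => by positivity)).trans ?_
    have hbound : ∀ p ∈ range (x + 1) ×ˢ range (y + 1),
        (((x - p.1) + (y - p.2)).choose (x - p.1) : ℝ) ^ 2 *
          ∑ R ∈ boxLists K j, (patternWeight p.1 p.2 R : ℝ) ^ 2 ≤
        2 ^ (x + y) * (coeff (p.1 + p.2) (invSqrtSeries ^ (j + 1)) *
            coeff (x + y - (p.1 + p.2)) invSqrtSeries) *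
          (((x - p.1) + (y - p.2)).choose (x - p.1) * (p.1 + p.2).choose p.1 : ℝ) := by
      intro p hp
      simp only [mem_product, mem_range] at hp
      have h1 := choose_le_two_pow_div_sqrt ((x - p.1) + (y - p.2)) (x - p.1)
      rw [← coeff_invSqrtSeries] at h1
      have h2 := ih p.1 p.2
      have h3 := coeff_pow_invSqrtSeries_nonneg (j + 1) (p.1 + p.2)
      calc _ ≤ (((x - p.1) + (y - p.2)).choose (x - p.1) : ℝ) *
            (2 ^ ((x - p.1) + (y - p.2)) * coeff ((x - p.1) + (y - p.2)) invSqrtSeries) *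
            ((p.1 + p.2).choose p.1 *
              (2 ^ (p.1 + p.2) * coeff (p.1 + p.2) (invSqrtSeries ^ (j + 1)))) := by
            have h4 : 0 ≤ coeff ((x - p.1) + (y - p.2)) invSqrtSeries := by
              rw [coeff_invSqrtSeries]; positivity
            rw [pow_two]; gcongr
        _ = _ := by
            rw [show x + y - (p.1 + p.2) = (x - p.1) + (y - p.2) by omega,
              show x + y = ((x - p.1) + (y - p.2)) + (p.1 + p.2) by omega, pow_add]
            ring
    refine (sum_le_sum hbound).trans ?_
    refine (sum_box_vandermonde_le x y (fun t => 2 ^ (x + y) *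
      (coeff t (invSqrtSeries ^ (j + 1)) * coeff (x + y - t) invSqrtSeries)) ?_).trans ?_
    · intro t
      have h3 := coeff_pow_invSqrtSeries_nonneg (j + 1) t
      have h4 : 0 ≤ coeff (x + y - t) invSqrtSeries := by
        rw [coeff_invSqrtSeries]; positivity
      positivity
    · rw [← mul_sum, pow_succ _ (j + 1), coeff_mul,
        Finset.Nat.sum_antidiagonal_eq_sum_range_succ
          (fun a b => coeff a (invSqrtSeries ^ (j + 1)) * coeff b invSqrtSeries)]

end IncreasingSubsequences

/-! ### The second moment as a sum over patterns, and the mean -/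

namespace IncreasingSubsequences

open Finset

theorem card_perm_eqOn_le {n : ℕ} (U : Finset (Fin n)) (σ₀ : Equiv.Perm (Fin n)) :
    #{σ : Equiv.Perm (Fin n) | ∀ x ∈ U, σ x = σ₀ x} ≤ (n - #U).factorial := by
  have e := Fintype.card_congr (Equiv.Perm.subtypeEquivSubtypePerm (fun x : Fin n => x ∉ U))
  have h1 : Fintype.card {x : Fin n // x ∉ U} = n - #U := by
    rw [Fintype.card_subtype_compl]; simp
  rw [Fintype.card_perm, h1, Fintype.card_subtype] at e
  rw [e]
  refine card_le_card_of_injOn (fun σ => σ₀⁻¹ * σ) ?_ ?_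
  · intro σ hσ
    simp only [coe_filter, mem_univ, true_and, Set.mem_ofPred_eq, not_not] at hσ ⊢
    intro a ha
    simp [Equiv.Perm.mul_apply, hσ a ha]
  · intro σ _ τ _ h
    exact mul_left_cancel h

/-- An increasing map on a finite set is determined by its image. -/
theorem eqOn_of_strictMonoOn_of_image_eq {n : ℕ} {S : Finset (Fin n)} {σ τ : Fin n → Fin n}
    (hσ : StrictMonoOn σ S) (hτ : StrictMonoOn τ S) (h : S.image σ = S.image τ) :
    ∀ x ∈ S, σ x = τ x := by
  have hc : #(S.image σ) = #S := card_image_of_injOn hσ.injOn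
  have key : ∀ ρ : Fin n → Fin n, StrictMonoOn ρ S → S.image ρ = S.image σ →
      (fun i => ρ (S.orderEmbOfFin rfl i)) = (S.image σ).orderEmbOfFin hc := by
    intro ρ hρ hi
    apply orderEmbOfFin_unique
    · intro x
      rw [← hi]
      exact mem_image_of_mem _ (orderEmbOfFin_mem _ _ _)
    · intro i j hij
      exact hρ (orderEmbOfFin_mem _ _ _) (orderEmbOfFin_mem _ _ _)
        ((S.orderEmbOfFin rfl).strictMono hij)
  intro x hx
  have hx' : x ∈ Set.range (S.orderEmbOfFin rfl) := by rw [range_orderEmbOfFin]; exact hx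
  obtain ⟨i, rfl⟩ := hx'
  exact congrFun ((key σ hσ rfl).trans (key τ hτ h.symm).symm) i

/-- The permutations increasing on both `S` and `T`. -/
def increasingOn₂ {n : ℕ} (S T : Finset (Fin n)) : Finset (Equiv.Perm (Fin n)) :=
  {σ | (∀ i ∈ S, ∀ j ∈ S, i < j → σ i < σ j) ∧ ∀ i ∈ T, ∀ j ∈ T, i < j → σ i < σ j}

/-- The pairs of `k`-element sets of positions. -/
def indexPairs (n k : ℕ) : Finset (Finset (Fin n) × Finset (Fin n)) :=
  univ.powersetCard k ×ˢ univ.powersetCard k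

theorem card_union_of_mem_indexPairs {n k : ℕ} {p : Finset (Fin n) × Finset (Fin n)}
    (hp : p ∈ indexPairs n k) : #(p.1 ∪ p.2) = 2 * k - (commonPattern p.1 p.2).length := by
  simp only [indexPairs, mem_product, mem_powersetCard, subset_univ, true_and] at hp
  rw [length_commonPattern, card_union, hp.1, hp.2, two_mul]

/-- A permutation `σ` that is increasing on `S` and on `T` is determined on `S ∪ T` by the images
of `S` and `T`, and this pair of images has the same pattern as `(S, T)`. -/
theorem card_increasingOn₂_le {n k : ℕ} {p : Finset (Fin n) × Finset (Fin n)}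
    (hp : p ∈ indexPairs n k) :
    #(increasingOn₂ p.1 p.2) ≤
      (n - (2 * k - (commonPattern p.1 p.2).length)).factorial *
        #{q ∈ indexPairs n k | commonPattern q.1 q.2 = commonPattern p.1 p.2} := by
  rw [← card_union_of_mem_indexPairs hp]
  simp only [indexPairs, mem_product, mem_powersetCard, subset_univ, true_and] at hp
  have hmono : ∀ σ ∈ increasingOn₂ p.1 p.2, StrictMonoOn σ p.1 ∧ StrictMonoOn σ p.2 := by
    intro σ hσ
    simp only [increasingOn₂, mem_filter, mem_univ, true_and] at hσ
    exact ⟨fun i hi j hj h => hσ.1 i hi j hj h, fun i hi j hj h => hσ.2 i hi j hj h⟩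
  refine card_le_mul_card_image_of_maps_to
    (f := fun σ : Equiv.Perm (Fin n) => (p.1.image σ, p.2.image σ)) ?_ _ ?_
  · intro σ hσ
    obtain ⟨h1, h2⟩ := hmono σ hσ
    simp only [indexPairs, mem_filter, mem_product, mem_powersetCard, subset_univ, true_and]
    refine ⟨⟨?_, ?_⟩, commonPattern_image σ _ _ h1 h2 σ.injective⟩
    · rw [card_image_of_injective _ σ.injective, hp.1]
    · rw [card_image_of_injective _ σ.injective, hp.2]
  · intro q _
    rcases eq_empty_or_nonempty ((increasingOn₂ p.1 p.2).filter
      fun σ : Equiv.Perm (Fin n) => (p.1.image σ, p.2.image σ) = q) with h0 | ⟨σ₀, hσ₀⟩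
    · rw [h0]; simp
    · refine (card_le_card ?_).trans (card_perm_eqOn_le (p.1 ∪ p.2) σ₀)
      intro σ hσ
      rw [mem_filter] at hσ hσ₀
      rw [mem_filter]
      refine ⟨mem_univ _, fun x hx => ?_⟩
      have hq := hσ.2.trans hσ₀.2.symm
      rw [Prod.mk.injEq] at hq
      obtain ⟨h1, h2⟩ := hmono σ hσ.1
      obtain ⟨h3, h4⟩ := hmono σ₀ hσ₀.1
      rcases mem_union.mp hx with hx | hx
      · exact eqOn_of_strictMonoOn_of_image_eq h1 h3 hq.1 x hx
      · exact eqOn_of_strictMonoOn_of_image_eq h2 h4 hq.2 x hx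

theorem card_indexPairs_pattern_le (n k : ℕ) (R : List (ℕ × ℕ)) :
    #{q ∈ indexPairs n k | commonPattern q.1 q.2 = R} ≤
      pairCount n (k - R.length) (k - R.length) R := by
  have e : pairCount n (k - R.length) (k - R.length) R =
      #{q ∈ (range n).powerset ×ˢ (range n).powerset |
        #(q.1 \ q.2) = k - R.length ∧ #(q.2 \ q.1) = k - R.length ∧
          commonPattern q.1 q.2 = R} := by
    rw [card_filter, sum_product]; rfl
  rw [e]
  refine card_le_card_of_injOn (fun q => (q.1.image Fin.val, q.2.image Fin.val)) ?_ ?_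
  · intro q hq
    have hv : Function.Injective (Fin.val : Fin n → ℕ) := Fin.val_injective
    simp only [indexPairs, coe_filter, mem_product, mem_powersetCard, subset_univ, true_and,
      Set.mem_ofPred_eq] at hq
    obtain ⟨⟨h1, h2⟩, rfl⟩ := hq
    have hsub : ∀ X : Finset (Fin n), X.image Fin.val ⊆ range n := by
      intro X a ha
      obtain ⟨b, _, rfl⟩ := mem_image.mp ha
      simp
    simp only [coe_filter, mem_product, mem_powerset, Set.mem_ofPred_eq]
    refine ⟨⟨hsub _, hsub _⟩, ?_, ?_, ?_⟩
    · rw [← image_sdiff _ _ hv, card_image_of_injective _ hv, length_commonPattern, card_sdiff,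
        h1, inter_comm]
    · rw [← image_sdiff _ _ hv, card_image_of_injective _ hv, length_commonPattern, card_sdiff,
        h2]
    · exact commonPattern_image _ _ _ (fun _ _ _ _ h => h) (fun _ _ _ _ h => h) hv
  · rintro ⟨a, b⟩ _ ⟨a', b'⟩ _ h
    simp only [Prod.mk.injEq] at h ⊢
    exact ⟨image_injective Fin.val_injective h.1, image_injective Fin.val_injective h.2⟩

theorem sum_Z_sq_eq (n k : ℕ) :
    ∑ σ, Z n k σ ^ 2 = ∑ p ∈ indexPairs n k, #(increasingOn₂ p.1 p.2) := by
  have h : ∀ σ, Z n k σ ^ 2 = ∑ p ∈ indexPairs n k,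
      if σ ∈ increasingOn₂ p.1 p.2 then 1 else 0 := by
    intro σ
    rw [Z, pow_two, ← card_product, ← filter_product, card_filter, indexPairs]
    refine sum_congr rfl fun p _ => ?_
    simp [increasingOn₂]
  rw [sum_congr rfl fun σ _ => h σ, sum_comm]
  refine sum_congr rfl fun p _ => ?_
  rw [← card_filter, filter_mem_eq_inter, univ_inter]

theorem commonPattern_mem_boxLists {n k : ℕ} {p : Finset (Fin n) × Finset (Fin n)}
    (hp : p ∈ indexPairs n k) :
    commonPattern p.1 p.2 ∈ (range (k + 1)).biUnion (boxLists (n + 1)) := by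
  simp only [indexPairs, mem_product, mem_powersetCard, subset_univ, true_and] at hp
  rw [mem_biUnion]
  refine ⟨(commonPattern p.1 p.2).length, ?_, mem_boxLists ?_⟩
  · rw [length_commonPattern, mem_range, Nat.lt_succ_iff, ← hp.1]
    exact card_le_card inter_subset_left
  · intro q hq
    obtain ⟨c, _, rfl⟩ := List.mem_map.mp hq
    constructor
    · exact Nat.lt_succ_of_le ((card_le_univ _).trans (by simp))
    · exact Nat.lt_succ_of_le ((card_le_univ _).trans (by simp))

theorem sum_Z_sq_le_nat (n k : ℕ) :
    ∑ σ, Z n k σ ^ 2 ≤ ∑ j ∈ range (k + 1), ∑ R ∈ boxLists (n + 1) j,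
      (n - (2 * k - j)).factorial *
        (n.choose (2 * k - j) * patternWeight (k - j) (k - j) R) ^ 2 := by
  rw [sum_Z_sq_eq]
  refine (sum_le_sum fun p hp => card_increasingOn₂_le hp).trans ?_
  rw [← sum_fiberwise_of_maps_to (g := fun p => commonPattern p.1 p.2)
    (fun p hp => commonPattern_mem_boxLists hp)]
  rw [sum_biUnion]
  · refine sum_le_sum fun j hj => sum_le_sum fun R hR => ?_
    have hlen := length_of_mem_boxLists hR
    have h1 := card_indexPairs_pattern_le n k R
    have h2 := pairCount_le n (k - R.length) (k - R.length) R
    have hj' := mem_range.mp hj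
    rw [hlen] at h1 h2
    rw [show k - j + (k - j) + j = 2 * k - j by omega] at h2
    have h3 := h1.trans h2
    have h4 : ∀ p ∈ {p ∈ indexPairs n k | commonPattern p.1 p.2 = R},
        (n - (2 * k - (commonPattern p.1 p.2).length)).factorial *
          #{q ∈ indexPairs n k | commonPattern q.1 q.2 = commonPattern p.1 p.2} =
        (n - (2 * k - j)).factorial * #{q ∈ indexPairs n k | commonPattern q.1 q.2 = R} := by
      intro p hp
      rw [(mem_filter.mp hp).2, hlen]
    rw [sum_congr rfl h4, sum_const, smul_eq_mul]
    calc _ = (n - (2 * k - j)).factorial *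
          #{q ∈ indexPairs n k | commonPattern q.1 q.2 = R} ^ 2 := by ring
      _ ≤ _ := by gcongr
  · intro i _ j _ hij
    rw [Function.onFun, disjoint_left]
    intro R hi hj
    exact hij ((length_of_mem_boxLists hi).symm.trans (length_of_mem_boxLists hj))

/-- Here `2 * k - j` is the size of the union of two `k`-element sets with `j` common
elements; the entries of their pattern are at most `n`. -/
theorem sum_Z_sq_le (n k : ℕ) :
    (∑ σ, (Z n k σ : ℝ) ^ 2) / n.factorial ≤ ∑ j ∈ range (k + 1),
      (n.choose (2 * k - j) : ℝ) / (2 * k - j).factorial *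
        ∑ R ∈ boxLists (n + 1) j, (patternWeight (k - j) (k - j) R : ℝ) ^ 2 := by
  have h : (∑ σ, (Z n k σ : ℝ) ^ 2) ≤ ∑ j ∈ range (k + 1), ∑ R ∈ boxLists (n + 1) j,
      ((n - (2 * k - j)).factorial : ℝ) *
        (n.choose (2 * k - j) * patternWeight (k - j) (k - j) R) ^ 2 := by
    exact_mod_cast sum_Z_sq_le_nat n k
  rw [div_le_iff₀ (by positivity), sum_mul]
  refine h.trans (sum_le_sum fun j _ => ?_)
  rw [mul_sum, sum_mul]
  refine sum_le_sum fun R _ => ?_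
  rcases le_or_gt (2 * k - j) n with hu | hu
  · have e : ((n.choose (2 * k - j) : ℝ)) * (2 * k - j).factorial * (n - (2 * k - j)).factorial =
        n.factorial := by exact_mod_cast Nat.choose_mul_factorial_mul_factorial hu
    rw [← e]
    have : ((2 * k - j).factorial : ℝ) ≠ 0 := by positivity
    field_simp
    exact le_refl _
  · rw [Nat.choose_eq_zero_of_lt hu]; simp

/-- Sorting the values at the positions in `S` makes every permutation increasing on `S`, so that
each of the `k!` ways of rearranging these positions accounts for an equal share of them. -/
theorem factorial_le_mul_card_increasing {n k : ℕ} {S : Finset (Fin n)} (hS : #S = k) :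
    n.factorial ≤ k.factorial *
      #{σ : Equiv.Perm (Fin n) | ∀ i ∈ S, ∀ j ∈ S, i < j → σ i < σ j} := by
  set e := S.orderEmbOfFin hS
  let ext : Equiv.Perm (Fin k) → Equiv.Perm (Fin n) :=
    fun τ => τ.viaFintypeEmbedding e.toEmbedding
  have hsub : (univ : Finset (Equiv.Perm (Fin n))) ⊆
      (univ ×ˢ univ.filter fun σ : Equiv.Perm (Fin n) =>
        ∀ i ∈ S, ∀ j ∈ S, i < j → σ i < σ j).image
        (fun q : Equiv.Perm (Fin k) × Equiv.Perm (Fin n) => q.2 * (ext q.1)⁻¹) := by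
    intro σ _
    let f : Fin k → Fin n := fun i => σ (e i)
    have hf : Function.Injective f := σ.injective.comp e.injective
    rw [mem_image]
    refine ⟨(Tuple.sort f, σ * ext (Tuple.sort f)), ?_, by simp⟩
    simp only [mem_product, mem_univ, mem_filter, true_and]
    have hmono : StrictMono (f ∘ Tuple.sort f) :=
      (Tuple.monotone_sort f).strictMono_of_injective (hf.comp (Tuple.sort f).injective)
    have hmem : ∀ x ∈ S, ∃ a, e a = x := by
      intro x hx
      have : x ∈ Set.range e := by rw [range_orderEmbOfFin]; exact hx
      exact this
    intro i hi j hj hij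
    obtain ⟨a, rfl⟩ := hmem i hi
    obtain ⟨b, rfl⟩ := hmem j hj
    have key : ∀ c, (σ * ext (Tuple.sort f)) (e c) = (f ∘ Tuple.sort f) c := by
      intro c
      have := Equiv.Perm.viaFintypeEmbedding_apply_image (Tuple.sort f) e.toEmbedding c
      rw [Equiv.Perm.mul_apply]
      exact congrArg σ this
    rw [key, key]
    exact hmono (e.lt_iff_lt.mp hij)
  have h := (card_le_card hsub).trans card_image_le
  rwa [card_product, card_univ, card_univ, Fintype.card_perm, Fintype.card_perm,
    Fintype.card_fin, Fintype.card_fin] at h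

theorem choose_div_factorial_le_mean (n k : ℕ) :
    (n.choose k : ℝ) / k.factorial ≤ (∑ σ, (Z n k σ : ℝ)) / n.factorial := by
  have h : ∑ σ, Z n k σ = ∑ S ∈ powersetCard k (univ : Finset (Fin n)),
      #{σ : Equiv.Perm (Fin n) | ∀ i ∈ S, ∀ j ∈ S, i < j → σ i < σ j} := by
    simp only [Z, card_filter]
    exact sum_comm
  have h2 : n.choose k * n.factorial ≤ k.factorial * ∑ σ, Z n k σ := by
    rw [h, mul_sum]
    calc n.choose k * n.factorial
        = ∑ S ∈ powersetCard k (univ : Finset (Fin n)), n.factorial := by simp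
      _ ≤ _ := sum_le_sum fun S hS =>
          factorial_le_mul_card_increasing (mem_powersetCard.mp hS).2
  rw [div_le_div_iff₀ (by positivity) (by positivity), mul_comm (∑ σ, (Z n k σ : ℝ))]
  exact_mod_cast h2

end IncreasingSubsequences

/-! ### The second moment relative to the square of the mean -/

namespace IncreasingSubsequences

open Finset

theorem descFactorial_mul_le {n k j : ℕ} (hj : j ≤ k) :
    n.descFactorial (2 * k - j) * n.descFactorial j ≤ n.descFactorial k ^ 2 := by
  have h1 : (n - k).descFactorial (k - j) * n.descFactorial k = n.descFactorial (2 * k - j) := by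
    have := Nat.descFactorial_mul_descFactorial (n := n) (show k ≤ 2 * k - j by omega)
    rwa [show 2 * k - j - k = k - j by omega] at this
  have h2 : (n - j).descFactorial (k - j) * n.descFactorial j = n.descFactorial k :=
    Nat.descFactorial_mul_descFactorial hj
  have h3 : (n - k).descFactorial (k - j) ≤ (n - j).descFactorial (k - j) :=
    Nat.descFactorial_le _ (by omega)
  calc _ = ((n - k).descFactorial (k - j) * n.descFactorial j) * n.descFactorial k := by
        rw [← h1]; ring
    _ ≤ ((n - j).descFactorial (k - j) * n.descFactorial j) * n.descFactorial k := by gcongr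
    _ = _ := by rw [h2, pow_two]

theorem half_pow_le_descFactorial {n k j : ℕ} (hj : j ≤ k) (hn : 2 * k ≤ n) :
    ((n : ℝ) / 2) ^ j ≤ n.descFactorial j := by
  have h1 : (((n + 1 - j : ℕ) : ℝ)) ^ j ≤ n.descFactorial j := by
    exact_mod_cast Nat.pow_sub_le_descFactorial n j
  refine le_trans ?_ h1
  gcongr
  rw [div_le_iff₀ (by norm_num)]
  exact_mod_cast (by omega : n ≤ (n + 1 - j) * 2)

theorem factorial_two_mul_le (k j : ℕ) (hj : j ≤ k) :
    (2 * k).factorial ≤ (2 * k - j).factorial * (2 * k) ^ j := by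
  rw [← Nat.factorial_mul_descFactorial (show j ≤ 2 * k by omega)]
  gcongr
  exact Nat.descFactorial_le_pow _ _

theorem centralBinom_mul_factorial_sq (k : ℕ) :
    k.centralBinom * k.factorial ^ 2 = (2 * k).factorial := by
  have h := Nat.choose_mul_factorial_mul_factorial (show k ≤ 2 * k by omega)
  rw [show 2 * k - k = k by omega] at h
  rw [Nat.centralBinom, ← h]; ring

/-- Comparison of `C(n, 2k - j) / (2k - j)!` with the square of `C(n, k) / k!`. -/
theorem choose_div_factorial_mul_le {n k j : ℕ} (hj1 : 1 ≤ j) (hj : j ≤ k) (hn : 2 * k ≤ n) :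
    (n.choose (2 * k - j) : ℝ) / (2 * k - j).factorial * (((n : ℝ) / 2) ^ j * 16 ^ k) ≤
      ((n.choose k : ℝ) / k.factorial) ^ 2 * (3 ^ j * (2 * k) * (2 * k) ^ (2 * j)) := by
  set u := 2 * k - j with hu
  have hd : (n.descFactorial u : ℝ) * n.descFactorial j ≤ n.descFactorial k ^ 2 := by
    exact_mod_cast descFactorial_mul_le hj
  have hf : ((2 * k).factorial : ℝ) ≤ u.factorial * (2 * k) ^ j := by
    exact_mod_cast factorial_two_mul_le k j hj
  have hc : (k.centralBinom : ℝ) * k.factorial ^ 2 = (2 * k).factorial := by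
    exact_mod_cast centralBinom_mul_factorial_sq k
  have hb : (16 : ℝ) ^ k ≤ k.centralBinom ^ 2 * (4 * k + 1) := by
    exact_mod_cast le_centralBinom_sq_mul k
  have hk1 : (1 : ℝ) ≤ k := by exact_mod_cast hj1.trans hj
  have h3 : (3 : ℝ) ≤ 3 ^ j := le_self_pow₀ (by norm_num) (by omega)
  have hb' : (16 : ℝ) ^ k ≤ k.centralBinom ^ 2 * (3 ^ j * (2 * k)) := by
    refine hb.trans ?_
    gcongr
    nlinarith
  have hu0 : (0 : ℝ) < u.factorial := by positivity
  have hk0 : (0 : ℝ) < k.factorial := by positivity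
  have e1 : (n.choose u : ℝ) = n.descFactorial u / u.factorial := by
    rw [Nat.descFactorial_eq_factorial_mul_choose]; push_cast; field_simp
  have e2 : (n.choose k : ℝ) = n.descFactorial k / k.factorial := by
    rw [Nat.descFactorial_eq_factorial_mul_choose]; push_cast; field_simp
  have hA : (n.descFactorial u : ℝ) * ((n : ℝ) / 2) ^ j ≤ n.descFactorial k ^ 2 := by
    refine le_trans ?_ hd
    gcongr
    exact half_pow_le_descFactorial hj hn
  have hB : (16 : ℝ) ^ k / u.factorial ^ 2 ≤
      3 ^ j * (2 * k) * (2 * k) ^ (2 * j) / k.factorial ^ 4 := by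
    rw [div_le_div_iff₀ (by positivity) (by positivity)]
    calc (16 : ℝ) ^ k * k.factorial ^ 4
        ≤ k.centralBinom ^ 2 * (3 ^ j * (2 * k)) * k.factorial ^ 4 := by gcongr
      _ = (3 ^ j * (2 * k)) * (k.centralBinom * k.factorial ^ 2 : ℝ) ^ 2 := by ring
      _ = (3 ^ j * (2 * k)) * ((2 * k).factorial : ℝ) ^ 2 := by rw [hc]
      _ ≤ (3 ^ j * (2 * k)) * (u.factorial * (2 * k) ^ j) ^ 2 := by gcongr
      _ = _ := by ring
  calc _ = ((n.descFactorial u : ℝ) * ((n : ℝ) / 2) ^ j) * (16 ^ k / u.factorial ^ 2) := by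
        rw [e1]; field_simp
    _ ≤ n.descFactorial k ^ 2 * (3 ^ j * (2 * k) * (2 * k) ^ (2 * j) / k.factorial ^ 4) := by
        gcongr
    _ = _ := by rw [e2]; field_simp

/-- The factor `√(2k)` on the left is the gain from `C(2N, N) ≤ 4ᴺ / √(2N + 1)`, where
`N = k - (i + 1)`. It is available for all `i`, even if `N` is small compared with `k`, because
`2k / (2N + 1) ≤ 4 ^ (i + 1)`. -/
theorem sum_patternWeight_sq_mul_le {K k i : ℕ} (hi : i + 1 ≤ k) :
    √((2 * k : ℕ) : ℝ) * ∑ R ∈ boxLists K (i + 1),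
      (patternWeight (k - (i + 1)) (k - (i + 1)) R : ℝ) ^ 2 ≤
      16 ^ (k - (i + 1)) * 24 ^ (i + 1) * √((2 * k : ℕ) : ℝ) ^ i / (i / 2).factorial := by
  obtain ⟨N, rfl⟩ := Nat.exists_eq_add_of_le hi
  rw [Nat.add_sub_cancel_left]
  set q := √((2 * (i + 1 + N) : ℕ) : ℝ) with hq
  have h1 := sum_patternWeight_sq_le K (i + 1) N N
  have h2 := coeff_pow_le i (N + N) (2 * (i + 1 + N)) (by omega)
  have h3 := choose_le_two_pow_div_sqrt (N + N) N
  have h4 : q * (1 / √((N + N : ℕ) + 1 : ℝ)) ≤ 2 ^ (i + 1) := by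
    rw [mul_one_div, div_le_iff₀ (by positivity), hq]
    have e : (2 : ℝ) ^ (i + 1) = √(4 ^ (i + 1)) := by
      rw [show (4 : ℝ) = 2 ^ 2 by norm_num, ← pow_mul, mul_comm 2, pow_mul,
        Real.sqrt_sq (by positivity)]
    rw [e, ← Real.sqrt_mul (by positivity)]
    apply Real.sqrt_le_sqrt
    have h5 : 2 * (i + 1) ≤ 4 ^ (i + 1) := by
      have h6 := Nat.lt_two_pow_self (n := i + 1)
      have h7 : 2 ≤ 2 ^ (i + 1) := by rw [pow_succ]; have := Nat.one_le_two_pow (n := i); omega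
      calc 2 * (i + 1) ≤ 2 ^ (i + 1) * 2 ^ (i + 1) := Nat.mul_le_mul h7 h6.le
        _ = 4 ^ (i + 1) := by rw [← mul_pow]; norm_num
    have h8 : 2 * (i + 1 + N) ≤ 4 ^ (i + 1) * (N + N + 1) := by
      calc 2 * (i + 1 + N) ≤ (2 * (i + 1)) * (N + N + 1) := by nlinarith
        _ ≤ _ := by gcongr
    exact_mod_cast h8
  rw [← hq] at h2
  have h2' := coeff_pow_invSqrtSeries_nonneg (i + 2) (N + N)
  have hq0 : 0 ≤ q := Real.sqrt_nonneg _
  calc _ ≤ q * ((2 ^ (N + N) * (1 / √((N + N : ℕ) + 1 : ℝ))) *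
        (2 ^ (N + N) * (12 ^ (i + 1) * q ^ i / (i / 2).factorial))) := by
        gcongr
        refine h1.trans ?_
        gcongr
    _ = (q * (1 / √((N + N : ℕ) + 1 : ℝ))) * ((2 ^ (N + N) * 2 ^ (N + N)) *
        (12 ^ (i + 1) * q ^ i / (i / 2).factorial)) := by ring
    _ ≤ 2 ^ (i + 1) * (16 ^ N * (12 ^ (i + 1) * q ^ i / (i / 2).factorial)) := by
        rw [show (2 : ℝ) ^ (N + N) * 2 ^ (N + N) = 16 ^ N by
          rw [← pow_add, show N + N + (N + N) = 4 * N by ring, pow_mul]; norm_num]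
        gcongr
    _ = _ := by
        rw [show (24 : ℝ) = 2 * 12 by norm_num, mul_pow]; ring

/-- The parameter `9 (2k)^{5/2} / n` in which the normalized second moment is bounded. -/
noncomputable def momentParam (n k : ℕ) : ℝ := 9 * √((2 * k : ℕ) : ℝ) ^ 5 / n

theorem momentParam_nonneg (n k : ℕ) : 0 ≤ momentParam n k := by
  unfold momentParam; positivity

/-- The pairs with `i + 1` common elements. -/
theorem overlap_term_le {n k i : ℕ} (hi : i + 1 ≤ k) (hn : 2 * k ≤ n) :
    (n.choose (2 * k - (i + 1)) : ℝ) / (2 * k - (i + 1)).factorial *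
        ∑ R ∈ boxLists (n + 1) (i + 1),
          (patternWeight (k - (i + 1)) (k - (i + 1)) R : ℝ) ^ 2 ≤
      ((n.choose k : ℝ) / k.factorial) ^ 2 *
        (momentParam n k ^ (i + 1) / (i / 2).factorial) := by
  have h1 := choose_div_factorial_mul_le (j := i + 1) (by omega) hi hn
  have h2 := sum_patternWeight_sq_mul_le (K := n + 1) hi
  set A := (n.choose (2 * k - (i + 1)) : ℝ) / (2 * k - (i + 1)).factorial
  set B := ∑ R ∈ boxLists (n + 1) (i + 1),
          (patternWeight (k - (i + 1)) (k - (i + 1)) R : ℝ) ^ 2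
  set V := ((n.choose k : ℝ) / k.factorial) ^ 2
  unfold momentParam
  set q := √((2 * k : ℕ) : ℝ) with hq
  have hq2 : (2 * k : ℝ) = q ^ 2 := by
    rw [hq, Real.sq_sqrt (by positivity)]; push_cast; ring
  have hk : (1 : ℝ) ≤ k := by exact_mod_cast (by omega : 1 ≤ k)
  have hq0 : 0 < q := Real.sqrt_pos.mpr (by push_cast; linarith)
  have hn0 : (0 : ℝ) < n := by exact_mod_cast (by omega : 0 < n)
  have hB : 0 ≤ B := sum_nonneg fun _ _ => by positivity
  have hV : 0 ≤ V := by positivity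
  rw [hq2] at h1
  have h16 : (16 : ℝ) ^ k = 16 ^ (k - (i + 1)) * 16 ^ (i + 1) := by
    rw [← pow_add, Nat.sub_add_cancel hi]
  have hpos : 0 < ((n : ℝ) / 2) ^ (i + 1) * 16 ^ k * q := by positivity
  refine le_of_mul_le_mul_right ?_ hpos
  calc A * B * (((n : ℝ) / 2) ^ (i + 1) * 16 ^ k * q)
      = (A * (((n : ℝ) / 2) ^ (i + 1) * 16 ^ k)) * (q * B) := by ring
    _ ≤ (V * (3 ^ (i + 1) * q ^ 2 * (q ^ 2) ^ (2 * (i + 1)))) *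
        (16 ^ (k - (i + 1)) * 24 ^ (i + 1) * q ^ i / (i / 2).factorial) := by
        gcongr
    _ = _ := by
        rw [h16, show (24 : ℝ) = 9 * 16 / (2 * 3) by norm_num]
        simp only [div_pow, mul_pow]
        field_simp
        ring

/-- The pairs without common elements. -/
theorem disjoint_term_le (n k : ℕ) :
    (n.choose (2 * k) : ℝ) / (2 * k).factorial * ((k + k).choose k : ℝ) ^ 2 ≤
      ((n.choose k : ℝ) / k.factorial) ^ 2 := by
  have h1 : (n.choose (2 * k) : ℝ) * k.centralBinom = n.choose k * (n - k).choose k := by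
    have := Nat.choose_mul (n := n) (show k ≤ 2 * k by omega)
    rw [show 2 * k - k = k by omega] at this
    exact_mod_cast this
  have hc : (k.centralBinom : ℝ) * k.factorial ^ 2 = (2 * k).factorial := by
    exact_mod_cast centralBinom_mul_factorial_sq k
  have h2 : ((n - k).choose k : ℝ) ≤ n.choose k := by
    exact_mod_cast Nat.choose_le_choose k (Nat.sub_le n k)
  have hb : (0 : ℝ) < k.centralBinom := by exact_mod_cast Nat.centralBinom_pos k
  rw [show (k + k).choose k = k.centralBinom by rw [Nat.centralBinom, two_mul]]
  calc _ = ((n.choose (2 * k) : ℝ) * k.centralBinom) / k.factorial ^ 2 := by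
        rw [← hc]; field_simp
    _ = (n.choose k * (n - k).choose k : ℝ) / k.factorial ^ 2 := by rw [h1]
    _ ≤ (n.choose k * n.choose k : ℝ) / k.factorial ^ 2 := by gcongr
    _ = _ := by ring

theorem sum_pow_div_factorial_half_le (k : ℕ) {y : ℝ} (hy : 0 ≤ y) :
    ∑ i ∈ range k, y ^ (i + 1) / (i / 2).factorial ≤ (y + y ^ 2) * Real.exp (y ^ 2) := by
  have h1 : ∀ m, ∑ i ∈ range (2 * m), y ^ (i + 1) / (i / 2).factorial =
      (y + y ^ 2) * ∑ r ∈ range m, (y ^ 2) ^ r / r.factorial := by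
    intro m
    induction m with
    | zero => simp
    | succ m ih =>
      rw [mul_add, mul_one, sum_range_succ, sum_range_succ, ih, sum_range_succ _ m,
        show (2 * m + 1) / 2 = m by omega, show 2 * m / 2 = m by omega]
      ring
  calc _ ≤ ∑ i ∈ range (2 * k), y ^ (i + 1) / (i / 2).factorial :=
        sum_le_sum_of_subset_of_nonneg (range_subset_range.mpr (by omega))
          fun _ _ _ => by positivity
    _ ≤ _ := by
        rw [h1]
        gcongr
        exact Real.sum_le_exp_of_nonneg (by positivity) k

/-- Bound for the relative excess of the second moment over the square of the mean, as a function of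
`momentParam`. -/
noncomputable def excess (y : ℝ) : ℝ := (y + y ^ 2) * Real.exp (y ^ 2)

theorem second_moment_le {n k : ℕ} (hn : 2 * k ≤ n) :
    (∑ σ, (Z n k σ : ℝ) ^ 2) / n.factorial ≤
      ((n.choose k : ℝ) / k.factorial) ^ 2 * (1 + excess (momentParam n k)) := by
  refine (sum_Z_sq_le n k).trans ?_
  rw [sum_range_succ', add_comm, mul_add, mul_one]
  apply add_le_add
  · simpa [boxLists, patternWeight] using disjoint_term_le n k
  · calc _ ≤ ∑ i ∈ range k, ((n.choose k : ℝ) / k.factorial) ^ 2 *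
          (momentParam n k ^ (i + 1) / (i / 2).factorial) :=
        sum_le_sum fun i hi => overlap_term_le (mem_range.mp hi) hn
      _ ≤ _ := by
        rw [← mul_sum]
        gcongr
        exact sum_pow_div_factorial_half_le k (momentParam_nonneg n k)

end IncreasingSubsequences

/-! ### Asymptotics -/

namespace IncreasingSubsequences

instance isProbabilityMeasure_U (n : ℕ) : IsProbabilityMeasure (U n) := by
  unfold U; infer_instance

theorem integral_U (n : ℕ) (f : Equiv.Perm (Fin n) → ℝ) :
    ∫ σ, f σ ∂(U n) = (∑ σ, f σ) / n.factorial := by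
  have : MeasurableSingletonClass (Equiv.Perm (Fin n)) := ⟨fun _ => trivial⟩
  rw [U, PMF.integral_eq_sum, Finset.sum_div]
  refine Finset.sum_congr rfl fun σ _ => ?_
  simp [PMF.uniformOfFintype_apply, Fintype.card_perm, div_eq_inv_mul]

theorem integrable_U (n : ℕ) (f : Equiv.Perm (Fin n) → ℝ) : Integrable f (U n) := by
  have : MeasurableSingletonClass (Equiv.Perm (Fin n)) := ⟨fun _ => trivial⟩
  exact Integrable.of_finite

theorem integral_indicator_U (n : ℕ) (A : Set (Equiv.Perm (Fin n))) :
    ∫ σ, A.indicator 1 σ ∂(U n) = (U n).real A :=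
  integral_indicator_one trivial

theorem EZ_pos {n k : ℕ} (h : k ≤ n) : 0 < EZ n k := by
  rw [EZ, integral_U]
  refine lt_of_lt_of_le ?_ (choose_div_factorial_le_mean n k)
  have : (0 : ℝ) < n.choose k := by exact_mod_cast Nat.choose_pos h
  positivity

theorem integral_normalized {n k : ℕ} (h : k ≤ n) : ∫ σ, (Z n k σ : ℝ) / EZ n k ∂(U n) = 1 := by
  rw [integral_div]
  exact div_self (EZ_pos h).ne'

theorem integral_normalized_sq_le {n k : ℕ} (h : 2 * k ≤ n) :
    ∫ σ, ((Z n k σ : ℝ) / EZ n k) ^ 2 ∂(U n) ≤ 1 + excess (momentParam n k) := by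
  have hm := EZ_pos (show k ≤ n by omega)
  have h1 := second_moment_le h
  have hv : (n.choose k : ℝ) / k.factorial ≤ EZ n k := by
    rw [EZ, integral_U]; exact choose_div_factorial_le_mean n k
  have he : 0 ≤ excess (momentParam n k) := by
    have := momentParam_nonneg n k
    unfold excess; positivity
  simp only [div_pow]
  rw [integral_div, integral_U, div_le_iff₀ (by positivity), mul_comm]
  refine h1.trans ?_
  gcongr

/-- Chebyshev's inequality for `Z / EZ`. -/
theorem prob_deviation_le {n k : ℕ} (h : 2 * k ≤ n) {ε : ℝ} (hε : 0 < ε) :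
    (U n).real {σ | ε < |(Z n k σ : ℝ) / EZ n k - 1|} ≤ excess (momentParam n k) / ε ^ 2 := by
  have h1 := integral_normalized (show k ≤ n by omega)
  have h2 := integral_normalized_sq_le h
  set W : Equiv.Perm (Fin n) → ℝ := fun σ => (Z n k σ : ℝ) / EZ n k
  set A := {σ | ε < |W σ - 1|} with hA
  have h3 : ∫ σ, ε ^ 2 * A.indicator 1 σ ∂(U n) ≤ ∫ σ, (W σ ^ 2 - 2 * W σ + 1) ∂(U n) := by
    refine integral_mono (integrable_U _ _) (integrable_U _ _) fun σ => ?_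
    by_cases hσ : σ ∈ A
    · have h4 : ε < |W σ - 1| := hσ
      have h5 : ε ^ 2 ≤ (W σ - 1) ^ 2 := by
        rw [← sq_abs (W σ - 1)]; gcongr
      simp only [Set.indicator_of_mem hσ, Pi.one_apply]
      linarith
    · simp only [Set.indicator_of_notMem hσ]
      nlinarith [sq_nonneg (W σ - 1)]
  rw [integral_const_mul, integral_indicator_U, integral_add (integrable_U _ _) (integrable_U _ _),
    integral_sub (integrable_U _ _) (integrable_U _ _), integral_const_mul, integral_const] at h3
  change ∫ σ, W σ ∂(U n) = 1 at h1
  change ∫ σ, W σ ^ 2 ∂(U n) ≤ _ at h2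
  rw [h1] at h3
  simp only [probReal_univ, smul_eq_mul] at h3
  rw [le_div_iff₀ (by positivity)]
  linarith

/-- The Paley–Zygmund inequality for `Z / EZ`. -/
theorem le_prob_half_lt {n k : ℕ} (h : 2 * k ≤ n) {K : ℝ} (hK : 0 < K)
    (hle : 1 + excess (momentParam n k) ≤ K) :
    1 / (4 * K) ≤ (U n).real {σ | 1 / 2 < (Z n k σ : ℝ) / EZ n k} := by
  have h1 := integral_normalized (show k ≤ n by omega)
  have h2 := (integral_normalized_sq_le h).trans hle
  set W : Equiv.Perm (Fin n) → ℝ := fun σ => (Z n k σ : ℝ) / EZ n k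
  set A := {σ | 1 / 2 < W σ} with hA
  -- AM-GM replaces the Cauchy-Schwarz inequality for `W * 1_A`.
  have h3 : ∫ σ, W σ ∂(U n) ≤
      ∫ σ, (1 / (4 * K) * W σ ^ 2 + K * A.indicator 1 σ + 1 / 2) ∂(U n) := by
    refine integral_mono (integrable_U _ _) (integrable_U _ _) fun σ => ?_
    have h5 : 0 ≤ 1 / (4 * K) * W σ ^ 2 := by positivity
    by_cases hσ : σ ∈ A
    · simp only [Set.indicator_of_mem hσ, Pi.one_apply]
      have h4 : 1 / (4 * K) * W σ ^ 2 + K - W σ = 1 / (4 * K) * (W σ - 2 * K) ^ 2 := by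
        field_simp; ring
      have h6 : 0 ≤ 1 / (4 * K) * (W σ - 2 * K) ^ 2 := by positivity
      linarith
    · simp only [Set.indicator_of_notMem hσ]
      have h4 : ¬ 1 / 2 < W σ := hσ
      linarith
  rw [integral_add (integrable_U _ _) (integrable_U _ _),
    integral_add (integrable_U _ _) (integrable_U _ _), integral_const_mul, integral_const_mul,
    integral_indicator_U, integral_const] at h3
  change ∫ σ, W σ ∂(U n) = 1 at h1
  change ∫ σ, W σ ^ 2 ∂(U n) ≤ _ at h2
  rw [h1] at h3
  simp only [probReal_univ, smul_eq_mul] at h3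
  have h4 : 1 / (4 * K) * ∫ σ, W σ ^ 2 ∂(U n) ≤ 1 / 4 := by
    calc _ ≤ 1 / (4 * K) * K := by gcongr
      _ = 1 / 4 := by field_simp
  rw [div_le_iff₀ (by positivity)]
  linarith

theorem momentParam_le {n k : ℕ} (hn : 1 ≤ n) {c : ℝ} (hc : 0 ≤ c)
    (h : (k : ℝ) ≤ c * (n : ℝ) ^ (2 / 5 : ℝ)) : momentParam n k ≤ 9 * √(2 * c) ^ 5 := by
  have hn' : (0 : ℝ) < n := by exact_mod_cast hn
  have hr : (n : ℝ) ^ (2 / 5 : ℝ) = ((n : ℝ) ^ (1 / 5 : ℝ)) ^ 2 := by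
    rw [← Real.rpow_natCast, ← Real.rpow_mul hn'.le]; norm_num
  have hr5 : ((n : ℝ) ^ (1 / 5 : ℝ)) ^ 5 = n := by
    rw [← Real.rpow_natCast, ← Real.rpow_mul hn'.le]; norm_num
  have hs : √((2 * k : ℕ) : ℝ) ≤ √(2 * c) * (n : ℝ) ^ (1 / 5 : ℝ) := by
    apply Real.sqrt_le_iff.mpr
    refine ⟨by positivity, ?_⟩
    rw [mul_pow, Real.sq_sqrt (by positivity), ← hr]
    push_cast; linarith
  unfold momentParam
  rw [div_le_iff₀ hn']
  calc _ ≤ 9 * (√(2 * c) * (n : ℝ) ^ (1 / 5 : ℝ)) ^ 5 := by gcongr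
    _ = _ := by rw [mul_pow, hr5]; ring

theorem eventually_two_mul_le {k : ℕ → ℕ}
    (h : (fun n : ℕ => (k n : ℝ)) =O[atTop] (fun n : ℕ => (n : ℝ) ^ (2 / 5 : ℝ))) :
    ∀ᶠ n in atTop, 2 * k n ≤ n := by
  have h1 : (fun n : ℕ => (n : ℝ) ^ (2 / 5 : ℝ)) =o[atTop] (fun n : ℕ => (n : ℝ)) := by
    refine isLittleO_of_tendsto' ?_ ?_
    · filter_upwards [eventually_ge_atTop 1] with n hn h0
      exact absurd h0 (by positivity)
    · refine ((tendsto_rpow_neg_atTop (show (0 : ℝ) < 3 / 5 by norm_num)).comp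
        tendsto_natCast_atTop_atTop).congr' ?_
      filter_upwards [eventually_ge_atTop 1] with n hn
      have hn' : (0 : ℝ) < n := by exact_mod_cast hn
      rw [Function.comp_apply, eq_div_iff hn'.ne', ← Real.rpow_add_one hn'.ne']
      norm_num
  filter_upwards [(h.trans_isLittleO h1).bound (show (0 : ℝ) < 1 / 2 by norm_num)] with n hn
  simp only [Real.norm_natCast] at hn
  have : (2 * k n : ℝ) ≤ n := by linarith
  exact_mod_cast this

theorem tendsto_momentParam {k : ℕ → ℕ}
    (h : (fun n : ℕ => (k n : ℝ)) =o[atTop] (fun n : ℕ => (n : ℝ) ^ (2 / 5 : ℝ))) :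
    Tendsto (fun n => momentParam n (k n)) atTop (𝓝 0) := by
  have h1 := h.tendsto_div_nhds_zero
  have hcont : Continuous fun c : ℝ => 9 * √(2 * c) ^ 5 := by fun_prop
  have h2 : Tendsto (fun n : ℕ => 9 * √(2 * ((k n : ℝ) / (n : ℝ) ^ (2 / 5 : ℝ))) ^ 5) atTop
      (𝓝 0) := by
    have h3 := (hcont.tendsto 0).comp h1
    simp only [mul_zero, Real.sqrt_zero, ne_eq, OfNat.ofNat_ne_zero, not_false_eq_true,
      zero_pow] at h3
    exact h3
  refine tendsto_of_tendsto_of_tendsto_of_le_of_le' tendsto_const_nhds h2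
    (Eventually.of_forall fun n => momentParam_nonneg _ _) ?_
  filter_upwards [eventually_ge_atTop 1] with n hn
  have hn' : (0 : ℝ) < n := by exact_mod_cast hn
  refine momentParam_le hn (by positivity) ?_
  rw [div_mul_cancel₀ _ (by positivity)]

theorem excess_mono {y z : ℝ} (hy : 0 ≤ y) (h : y ≤ z) : excess y ≤ excess z := by
  unfold excess
  have hz := hy.trans h
  gcongr

end IncreasingSubsequences

theorem corollary1 (k : ℕ → ℕ) :
    ((fun n : ℕ => (k n : ℝ)) =o[atTop] (fun n : ℕ => (n : ℝ) ^ (2 / 5 : ℝ)) →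
      ∀ ε : ℝ, 0 < ε →
        Tendsto
          (fun n : ℕ => (IncreasingSubsequences.U n).real
            {σ | ε < |(IncreasingSubsequences.Z n (k n) σ : ℝ) /
              IncreasingSubsequences.EZ n (k n) - 1|})
          atTop (𝓝 0)) ∧
    ((fun n : ℕ => (k n : ℝ)) =O[atTop] (fun n : ℕ => (n : ℝ) ^ (2 / 5 : ℝ)) →
      ∃ δ : ℝ, 0 < δ ∧
        0 < liminf
          (fun n : ℕ => (IncreasingSubsequences.U n).real
            {σ | δ < (IncreasingSubsequences.Z n (k n) σ : ℝ) /
              IncreasingSubsequences.EZ n (k n)})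
          atTop) := by
  constructor
  · intro h ε hε
    have hcont : Continuous fun y => IncreasingSubsequences.excess y / ε ^ 2 := by
      unfold IncreasingSubsequences.excess; fun_prop
    have h1 : Tendsto (fun n => IncreasingSubsequences.excess
        (IncreasingSubsequences.momentParam n (k n)) / ε ^ 2) atTop (𝓝 0) := by
      have h2 := (hcont.tendsto 0).comp (IncreasingSubsequences.tendsto_momentParam h)
      have h0 : IncreasingSubsequences.excess 0 / ε ^ 2 = 0 := by
        simp [IncreasingSubsequences.excess]
      rwa [h0] at h2
    refine tendsto_of_tendsto_of_tendsto_of_le_of_le' tendsto_const_nhds h1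
      (Eventually.of_forall fun n => measureReal_nonneg) ?_
    filter_upwards [IncreasingSubsequences.eventually_two_mul_le h.isBigO] with n hn
    exact IncreasingSubsequences.prob_deviation_le hn hε
  · intro h
    refine ⟨1 / 2, by norm_num, ?_⟩
    obtain ⟨c, hc, hb⟩ := h.exists_pos
    set K := 1 + IncreasingSubsequences.excess (9 * √(2 * c) ^ 5) with hKdef
    have hK : 0 < K := by
      rw [hKdef]; unfold IncreasingSubsequences.excess; positivity
    refine lt_of_lt_of_le (show 0 < 1 / (4 * K) by positivity) ?_
    refine le_liminf_of_le ?_ ?_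
    · exact IsBoundedUnder.isCoboundedUnder_ge
        ⟨1, eventually_map.mpr (Eventually.of_forall fun n => measureReal_le_one)⟩
    · filter_upwards [IncreasingSubsequences.eventually_two_mul_le h, hb.bound,
        eventually_ge_atTop 1] with n hn hkn hn1
      refine IncreasingSubsequences.le_prob_half_lt hn hK ?_
      rw [hKdef]
      gcongr
      refine IncreasingSubsequences.excess_mono (IncreasingSubsequences.momentParam_nonneg _ _)
        (IncreasingSubsequences.momentParam_le hn1 hc.le ?_)
      rwa [Real.norm_natCast, Real.norm_of_nonneg (by positivity)] at hkn
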